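/- Let $q\ge 1$ and $n\ge 0$ be integers, let $M,K\in\mathbb{R}^{n\times n}$ be symmetric positive definite, and let $D_{ij}\in\mathbb{R}^{n\times n}$ ($i,j=1,\dots,q$) satisfy $D_{ij}=D_{ij}^T=D_{ji}\ge 0$ and $D_{ii}=0$. Consider the purely dissipatively coupled array $$M\ddot x_i+Kx_i+\sum_{j=1}^q D_{ij}(\dot x_i-\dot x_j)=0,\qquad i=1,\dots,q,\quad x_i(t)\in\mathbb{R}^n .$$ The array is said to synchronize if $\|x_i(t)-x_j(t)\|\to 0$ as $t\to\infty$ for all $i,j$ and all solutions (that is, for all initial conditions). Let $P=M^{-1/2}KM^{-1/2}$ and assume that its eigenvalues $\sigma_1,\dots,\sigma_n$ are distinct; let $v_1,\dots,v_n\in\mathbb{R}^n$ be corresponding unit eigenvectors, $Pv_k=\sigma_kv_k$. Let $L_{\rm d}\in\mathbb{R}^{qn\times qn}$ be the matrix-weighted Laplacian with weights $W_{ij}=M^{-1/2}D_{ij}M^{-1/2}$, i.e. the block matrix whose $i$th diagonal block is $\sum_{j}W_{ij}$ and whose $(i,j)$ block for $i\ne j$ is $-W_{ij}$, and put $$G_{kk}=[I_q\otimes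 v_k^T]\,L_{\rm d}\,[I_q\otimes v_k]\in\mathbb{R}^{q\times q},\qquad k=1,\dots,n .$$ Theorem. The array synchronizes if and only if, for every $k=1,\dots,n$, zero is a simple eigenvalue of $G_{kk}$ (algebraic multiplicity one). If $q\ge 2$, the array synchronizes if and only if $\lambda_2(G_{kk})>0$ for all $k=1,\dots,n$, where $\lambda_2(G_{kk})$ denotes the second smallest eigenvalue (counted with multiplicity) of the real symmetric matrix $G_{kk}$. -/

import Mathlib

open scoped Matrix Kronecker MatrixOrder

noncomputable section

namespace SmallOscillations

/-- The inverse square root `M^{-1/2}` of a positive definite matrix `M`, i.e. the inverse of its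
positive semidefinite square root. -/
def invSqrt {n : ℕ} (M : Matrix (Fin n) (Fin n) ℝ) : Matrix (Fin n) (Fin n) ℝ :=
  (CFC.sqrt M)⁻¹

/-- `P = M^{-1/2} K M^{-1/2}`. -/
def normalizedStiffness {n : ℕ} (M K : Matrix (Fin n) (Fin n) ℝ) : Matrix (Fin n) (Fin n) ℝ :=
  invSqrt M * K * invSqrt M

/-- The matrix-weighted Laplacian `lap (W i j)`, a `q × q` block matrix with blocks of size `n × n`:
the diagonal blocks are `∑ l, W i l`, the off-diagonal blocks are `-W i j`. -/
def lap {q n : ℕ} (W : Fin q → Fin q → Matrix (Fin n) (Fin n) ℝ) :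
    Matrix (Fin q × Fin n) (Fin q × Fin n) ℝ :=
  Matrix.of fun r c => if r.1 = c.1 then ∑ l, W r.1 l r.2 c.2 else -W r.1 c.1 r.2 c.2

/-- The dissipative Laplacian `L_d = lap (M^{-1/2} D i j M^{-1/2})`. -/
def dissipativeLaplacian {q n : ℕ} (M : Matrix (Fin n) (Fin n) ℝ)
    (D : Fin q → Fin q → Matrix (Fin n) (Fin n) ℝ) :
    Matrix (Fin q × Fin n) (Fin q × Fin n) ℝ :=
  lap fun i j => invSqrt M * D i j * invSqrt M

/-- The `q × q` matrix `[I_q ⊗ vᵀ] L [I_q ⊗ v]` (with `v` regarded as an `n × 1` column). -/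
def projectedLaplacian {q n : ℕ} (L : Matrix (Fin q × Fin n) (Fin q × Fin n) ℝ)
    (v : Fin n → ℝ) : Matrix (Fin q) (Fin q) ℝ :=
  (((1 : Matrix (Fin q) (Fin q) ℝ) ⊗ₖ Matrix.replicateRow Unit v) * L *
    ((1 : Matrix (Fin q) (Fin q) ℝ) ⊗ₖ Matrix.replicateCol Unit v)).submatrix
      (fun i => (i, ())) (fun i => (i, ()))

theorem length_sort_re_roots {m : ℕ} (X : Matrix (Fin m) (Fin m) ℂ) :
    ((X.charpoly.roots.map Complex.re).sort (· ≤ ·)).length = m := by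
  rw [Multiset.length_sort, Multiset.card_map,
    (Polynomial.splits_iff_card_roots.mp (IsAlgClosed.splits X.charpoly)),
    Matrix.charpoly_natDegree_eq_dim, Fintype.card_fin]

/-- The eigenvalues of `X`, with algebraic multiplicity, are ordered by increasing real part
`Re λ₁ ≤ Re λ₂ ≤ ⋯ ≤ Re λₘ`; `reEigenvalue X k` is `Re λₖ₊₁` (the index `k` starts at `0`). -/
def reEigenvalue {m : ℕ} (X : Matrix (Fin m) (Fin m) ℂ) (k : Fin m) : ℝ :=
  ((X.charpoly.roots.map Complex.re).sort (· ≤ ·)).get (k.cast (length_sort_re_roots X).symm)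

/-- `x` is a solution of the purely dissipatively coupled array
`M ẍᵢ + K xᵢ + ∑ⱼ D i j (ẋᵢ - ẋⱼ) = 0`, where `y = ẋ` and `a = ẍ`. -/
def IsSolution {q n : ℕ} (M K : Matrix (Fin n) (Fin n) ℝ)
    (D : Fin q → Fin q → Matrix (Fin n) (Fin n) ℝ) (x : Fin q → ℝ → Fin n → ℝ) : Prop :=
  ∃ y a : Fin q → ℝ → Fin n → ℝ, ∀ i t,
    HasDerivAt (x i) (y i t) t ∧ HasDerivAt (y i) (a i t) t ∧
      M *ᵥ a i t + K *ᵥ x i t + ∑ j, D i j *ᵥ (y i t - y j t) = 0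

/-- The array synchronizes: `‖xᵢ(t) - xⱼ(t)‖ → 0` (Euclidean norm) as `t → ∞`, for all `i`, `j` and
all solutions, i.e. for all initial conditions. -/
def Synchronizes {q n : ℕ} (M K : Matrix (Fin n) (Fin n) ℝ)
    (D : Fin q → Fin q → Matrix (Fin n) (Fin n) ℝ) : Prop :=
  ∀ x : Fin q → ℝ → Fin n → ℝ, IsSolution M K D x →
    ∀ i j, Filter.Tendsto (fun t => ‖WithLp.toLp 2 (x i t - x j t)‖) Filter.atTop (nhds 0)

end SmallOscillations

end

/-! With `S = M^{-1/2}` and `U` the orthogonal matrix with columns `v k`, the substitution by `S *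
U` turns `M` into `1`, `K` into `diagonal σ` and the couplings into `B i j = (S * U)ᵀ * D i j * (S *
U)`. Then `G k` is the graph Laplacian with scalar weights `B i j k k`.

If every `G k` has only the constants in its kernel, energy is a Lyapunov function, and by LaSalle
(`tendsto_of_constant_energy`) only orbits of constant energy matter. Along these `B i j *ᵥ (y i - y
j) = 0`, so the oscillators decouple. Row `k` is then a vanishing combination of harmonic motions
with distinct frequencies, hence vanishes term by term (`mul_eq_zero_of_forall_sum_mul_eq_zero`).
Its diagonal term puts the `k`th velocities in `ker (G k)`, so they agree.

Conversely, a vector `c` in `ker (G k)` yields the undamped motion `c i * cos (√(σ k) * t)` in mode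
`k`, which synchronizes only if `c` is constant (`eq_of_modal_synchronizes`).

Since `G k` is positive semidefinite and kills the constants, this kernel condition says that zero
is a simple eigenvalue, or that the second eigenvalue is positive. -/

namespace SmallOscillations

open Filter Topology

/-! ### LaSalle's principle for linear flows -/

section LaSalle

variable {V : Type*} [NormedAddCommGroup V] [NormedSpace ℝ V]

theorem hasDerivAt_exp_smul_apply [CompleteSpace V] (A : V →L[ℝ] V) (v : V) (t : ℝ) :
    HasDerivAt (fun s : ℝ => NormedSpace.exp (s • A) v) (A (NormedSpace.exp (t • A) v)) t := by
  have h := (hasDerivAt_exp_smul_const' (𝕂 := ℝ) A t)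
  simpa using h.clm_apply (hasDerivAt_const t v)

theorem solution_eq_exp_smul [CompleteSpace V] (A : V →L[ℝ] V) {z : ℝ → V}
    (hz : ∀ t, HasDerivAt z (A (z t)) t) (s t : ℝ) :
    z (s + t) = NormedSpace.exp (t • A) (z s) := by
  have hshift : ∀ t, HasDerivAt (fun r => z (s + r)) (A (z (s + t))) t := fun t =>
    (hz (s + t)).comp_const_add s t
  have h := ODE_solution_unique_univ (v := fun _ => A) (s := fun _ => Set.univ) (K := ‖A‖₊)
    (f := fun r => z (s + r)) (g := fun r => NormedSpace.exp (r • A) (z s)) (t₀ := 0)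
    (fun _ => A.lipschitz.lipschitzOnWith) (fun t => ⟨hshift t, trivial⟩)
    (fun t => ⟨hasDerivAt_exp_smul_apply A (z s) t, trivial⟩) (by simp [NormedSpace.exp_zero])
  exact congrFun h t

/-- LaSalle's invariance principle for a linear flow with a proper Lyapunov function `E`: if an
observable `Φ` takes the value `c` on all orbits along which `E` is constant, then `Φ` converges
to `c` along every orbit. -/
theorem tendsto_of_constant_energy [FiniteDimensional ℝ V] {F : Type*} [TopologicalSpace F]
    (A : V →L[ℝ] V) {E : V → ℝ} (hE : Continuous E) {Φ : V → F} (hΦ : Continuous Φ) {c : F}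
    (hE_nonneg : ∀ v, 0 ≤ E v) (hE_bdd : ∀ C, Bornology.IsBounded {v | E v ≤ C})
    (hE_anti : ∀ z : ℝ → V, (∀ t, HasDerivAt z (A (z t)) t) → Antitone fun t => E (z t))
    (hconst : ∀ z : ℝ → V, (∀ t, HasDerivAt z (A (z t)) t) → (∀ s t, E (z s) = E (z t)) →
      Φ (z 0) = c)
    {z : ℝ → V} (hz : ∀ t, HasDerivAt z (A (z t)) t) :
    Tendsto (fun t => Φ (z t)) atTop (𝓝 c) := by
  have : CompleteSpace V := FiniteDimensional.complete ℝ V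
  have : ProperSpace V := FiniteDimensional.proper ℝ V
  have hanti := hE_anti z hz
  have hlim : Tendsto (fun t => E (z t)) atTop (𝓝 (⨅ t, E (z t))) :=
    tendsto_atTop_ciInf hanti ⟨0, by rintro _ ⟨t, rfl⟩; exact hE_nonneg _⟩
  refine tendsto_of_subseq_tendsto fun ns hns => ?_
  -- Past index `N` the times are nonnegative, so the energy stays below `E (z 0)` and the orbit
  -- points are bounded.
  obtain ⟨N, hN⟩ := (hns.eventually_ge_atTop 0).exists_forall_of_atTop
  obtain ⟨a, -, φ, hφ, ha⟩ := tendsto_subseq_of_bounded (hE_bdd (E (z 0)))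
    (x := fun m => z (ns (m + N))) fun m => hanti (hN _ (Nat.le_add_left _ _))
  have hns' : Tendsto (fun m => ns (φ m + N)) atTop atTop :=
    hns.comp (tendsto_atTop_mono (fun m => Nat.le_add_right _ N) hφ.tendsto_atTop)
  -- The orbit through the limit point `a` has constant energy: a time shift by `t` does not change
  -- the limit of `E` along `z`.
  have hflow : ∀ t : ℝ, E (NormedSpace.exp (t • A) a) = ⨅ t, E (z t) := by
    intro t
    have h1 : Tendsto (fun m => E (NormedSpace.exp (t • A) (z (ns (φ m + N))))) atTop
        (𝓝 (E (NormedSpace.exp (t • A) a))) :=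
      ((hE.comp (NormedSpace.exp (t • A)).continuous).tendsto a).comp ha
    have h2 : Tendsto (fun m => E (z (ns (φ m + N) + t))) atTop (𝓝 (⨅ t, E (z t))) :=
      hlim.comp (tendsto_atTop_add_const_right _ t hns')
    simp only [solution_eq_exp_smul A hz] at h2
    exact tendsto_nhds_unique h1 h2
  have hc := hconst (fun t => NormedSpace.exp (t • A) a)
    (fun t => hasDerivAt_exp_smul_apply A a t) (fun s t => by rw [hflow, hflow])
  simp only [zero_smul, NormedSpace.exp_zero, one_apply_eq_self] at hc
  refine ⟨fun m => φ m + N, ?_⟩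
  rw [← hc]
  exact (hΦ.tendsto a).comp ha

end LaSalle

/-! ### Quadratic forms of weighted graph Laplacians -/

variable {q n : ℕ}

/-- Exchanging `i` and `j` reverses the force, as in Newton's third law; averaging the two forms of
the sum leaves only relative velocities. -/
theorem two_mul_sum_dotProduct_of_antisymm (y : Fin q → Fin n → ℝ)
    {F : Fin q → Fin q → Fin n → ℝ} (hF : ∀ i j, F j i = -F i j) :
    2 * ∑ i, y i ⬝ᵥ ∑ j, F i j = ∑ i, ∑ j, (y i - y j) ⬝ᵥ F i j := by
  have h : ∑ i, ∑ j, y j ⬝ᵥ F i j = -∑ i, ∑ j, y i ⬝ᵥ F i j := by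
    rw [Finset.sum_comm, ← Finset.sum_neg_distrib]
    refine Finset.sum_congr rfl fun i _ => ?_
    rw [← Finset.sum_neg_distrib]
    exact Finset.sum_congr rfl fun j _ => by rw [hF i j, dotProduct_neg]
  simp only [sub_dotProduct, Finset.sum_sub_distrib, h, dotProduct_sum]
  ring

/-- The Laplacian matrix of a graph on `Fin q` with scalar edge weights `g`. -/
def weightedLaplacian (g : Fin q → Fin q → ℝ) : Matrix (Fin q) (Fin q) ℝ :=
  Matrix.of fun i j => if i = j then ∑ l, g i l else -g i j

section weightedLaplacian

variable {g : Fin q → Fin q → ℝ}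

theorem weightedLaplacian_mulVec (hdiag : ∀ i, g i i = 0) (x : Fin q → ℝ) (i : Fin q) :
    (weightedLaplacian g *ᵥ x) i = ∑ j, g i j * (x i - x j) := by
  have h : ∀ j, weightedLaplacian g i j = (if i = j then ∑ l, g i l else 0) - g i j := by
    intro j
    by_cases hij : i = j
    · subst hij; simp [weightedLaplacian, hdiag]
    · simp [weightedLaplacian, hij]
  simp only [Matrix.mulVec, dotProduct, h, sub_mul, ite_mul, zero_mul, Finset.sum_sub_distrib,
    Finset.sum_ite_eq, Finset.mem_univ, if_true, mul_sub, Finset.sum_mul]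

theorem weightedLaplacian_mulVec_one (hdiag : ∀ i, g i i = 0) :
    weightedLaplacian g *ᵥ 1 = 0 := by
  ext i
  simp [weightedLaplacian_mulVec hdiag]

theorem two_mul_dotProduct_weightedLaplacian_mulVec (hsymm : ∀ i j, g i j = g j i)
    (hdiag : ∀ i, g i i = 0) (x : Fin q → ℝ) :
    2 * (x ⬝ᵥ weightedLaplacian g *ᵥ x) = ∑ i, ∑ j, g i j * (x i - x j) ^ 2 := by
  have h := two_mul_sum_dotProduct_of_antisymm (n := 1) (fun i _ => x i)
    (F := fun i j _ => g i j * (x i - x j))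
    (fun i j => by ext; simp only [Pi.neg_apply, hsymm j i]; ring)
  simp only [dotProduct, Finset.univ_unique, Finset.sum_singleton, Finset.sum_apply,
    Pi.sub_apply] at h
  simp only [dotProduct, weightedLaplacian_mulVec hdiag]
  rw [h]
  exact Finset.sum_congr rfl fun i _ => Finset.sum_congr rfl fun j _ => by ring

theorem weightedLaplacian_posSemidef (hsymm : ∀ i j, g i j = g j i) (hdiag : ∀ i, g i i = 0)
    (hg : ∀ i j, 0 ≤ g i j) : (weightedLaplacian g).PosSemidef := by
  refine Matrix.PosSemidef.of_dotProduct_mulVec_nonneg ?_ fun x => ?_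
  · ext i j
    by_cases hij : i = j
    · subst hij; simp
    · simp [weightedLaplacian, hij, Ne.symm hij, hsymm i j]
  · have h := two_mul_dotProduct_weightedLaplacian_mulVec hsymm hdiag x
    have h' : 0 ≤ ∑ i, ∑ j, g i j * (x i - x j) ^ 2 :=
      Finset.sum_nonneg fun i _ => Finset.sum_nonneg fun j _ => mul_nonneg (hg i j) (sq_nonneg _)
    rw [star_trivial]
    linarith

theorem mul_sub_eq_zero_of_weightedLaplacian_mulVec_eq_zero (hsymm : ∀ i j, g i j = g j i)
    (hdiag : ∀ i, g i i = 0) (hg : ∀ i j, 0 ≤ g i j) {x : Fin q → ℝ}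
    (hx : weightedLaplacian g *ᵥ x = 0) (i j : Fin q) : g i j * (x i - x j) = 0 := by
  have h := two_mul_dotProduct_weightedLaplacian_mulVec hsymm hdiag x
  have hnn : ∀ i j, 0 ≤ g i j * (x i - x j) ^ 2 := fun i j => mul_nonneg (hg i j) (sq_nonneg _)
  rw [hx, dotProduct_zero, mul_zero, eq_comm,
    Finset.sum_eq_zero_iff_of_nonneg fun i _ => Finset.sum_nonneg fun j _ => hnn i j] at h
  have h' := (Finset.sum_eq_zero_iff_of_nonneg fun j _ => hnn i j).mp (h i (Finset.mem_univ i)) j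
    (Finset.mem_univ j)
  rcases mul_eq_zero.mp h' with h0 | h0
  · rw [h0, zero_mul]
  · rw [pow_eq_zero_iff two_ne_zero |>.mp h0, mul_zero]

end weightedLaplacian

/-! ### Invariance of synchronization under congruence -/

theorem synchronizes_iff {M K : Matrix (Fin n) (Fin n) ℝ}
    {D : Fin q → Fin q → Matrix (Fin n) (Fin n) ℝ} :
    Synchronizes M K D ↔ ∀ x, IsSolution M K D x → ∀ i j,
      Tendsto (fun t => x i t - x j t) atTop (𝓝 0) := by
  refine forall₂_congr fun x _ => forall₂_congr fun i j => ?_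
  rw [← tendsto_zero_iff_norm_tendsto_zero]
  constructor
  · intro h
    simpa [Function.comp_def] using ((PiLp.continuous_ofLp 2 fun _ : Fin n => ℝ).tendsto 0).comp h
  · intro h
    simpa [Function.comp_def] using ((PiLp.continuous_toLp 2 fun _ : Fin n => ℝ).tendsto 0).comp h

/-- The new coordinates are `V *ᵥ x`; multiplying the equation of motion by `Wᵀ` gives the
transformed array. -/
theorem Synchronizes.of_congruence {M K W V : Matrix (Fin n) (Fin n) ℝ}
    {D : Fin q → Fin q → Matrix (Fin n) (Fin n) ℝ} (hWV : W * V = 1)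
    (h : Synchronizes (Wᵀ * M * W) (Wᵀ * K * W) fun i j => Wᵀ * D i j * W) :
    Synchronizes M K D := by
  rw [synchronizes_iff] at h ⊢
  have hcancel : ∀ u : Fin n → ℝ, W *ᵥ (V *ᵥ u) = u := fun u => by
    rw [Matrix.mulVec_mulVec, hWV, Matrix.one_mulVec]
  have hderiv : ∀ {f : ℝ → Fin n → ℝ} {f' : Fin n → ℝ} {t : ℝ}, HasDerivAt f f' t →
      HasDerivAt (fun s => V *ᵥ f s) (V *ᵥ f') t := fun hf =>
    (Matrix.mulVecLin V).toContinuousLinearMap.hasFDerivAt.comp_hasDerivAt _ hf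
  rintro x ⟨y, a, hx⟩ i j
  have hsol : IsSolution (Wᵀ * M * W) (Wᵀ * K * W) (fun i j => Wᵀ * D i j * W)
      (fun i t => V *ᵥ x i t) := by
    refine ⟨fun i t => V *ᵥ y i t, fun i t => V *ᵥ a i t, fun i t =>
      ⟨hderiv (hx i t).1, hderiv (hx i t).2.1, ?_⟩⟩
    have heq := congrArg (fun u => Wᵀ *ᵥ u) (hx i t).2.2
    simpa only [← Matrix.mulVec_mulVec, ← Matrix.mulVec_sub, hcancel, Matrix.mulVec_add,
      Matrix.mulVec_sum, Matrix.mulVec_zero] using heq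
  have hlim := ((Matrix.mulVecLin W).toContinuousLinearMap.continuous.tendsto 0).comp (h _ hsol i j)
  simpa [Function.comp_def, ← Matrix.mulVec_sub, hcancel] using hlim

theorem synchronizes_congruence_iff {M K W V : Matrix (Fin n) (Fin n) ℝ}
    {D : Fin q → Fin q → Matrix (Fin n) (Fin n) ℝ} (hWV : W * V = 1) :
    Synchronizes (Wᵀ * M * W) (Wᵀ * K * W) (fun i j => Wᵀ * D i j * W) ↔ Synchronizes M K D := by
  refine ⟨Synchronizes.of_congruence hWV, fun h => ?_⟩
  refine Synchronizes.of_congruence (mul_eq_one_comm.mp hWV) ?_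
  have hc : ∀ X : Matrix (Fin n) (Fin n) ℝ, Vᵀ * (Wᵀ * X * W) * V = X := fun X => by
    have hT : Vᵀ * Wᵀ = 1 := by rw [← Matrix.transpose_mul, hWV, Matrix.transpose_one]
    calc Vᵀ * (Wᵀ * X * W) * V = (Vᵀ * Wᵀ) * X * (W * V) := by simp only [mul_assoc]
      _ = X := by rw [hT, hWV, one_mul, mul_one]
  simpa only [hc] using h

/-- If a linear combination of velocities of uncoupled harmonic oscillators with distinct
frequencies vanishes for all time, then so does every term. -/
theorem mul_eq_zero_of_forall_sum_mul_eq_zero {σ : Fin n → ℝ} (hσ : Function.Injective σ)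
    {w u : Fin n → ℝ → ℝ} (hw : ∀ k t, HasDerivAt (w k) (u k t) t)
    (hu : ∀ k t, HasDerivAt (u k) (-(σ k * w k t)) t) {d : Fin n → ℝ}
    (h : ∀ t, ∑ k, d k * u k t = 0) (k : Fin n) (t : ℝ) : d k * u k t = 0 := by
  -- Two differentiations multiply the `k`th term by `-σ k`, so all moments in `σ` vanish; a
  -- Vandermonde argument for distinct `σ k` then finishes.
  have hpow : ∀ (m : ℕ) (t : ℝ), ∑ k, d k * u k t * σ k ^ m = 0 := by
    intro m
    induction m with
    | zero => simpa using h
    | succ m ih =>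
      have h1 : ∀ t, ∑ k, d k * -(σ k * w k t) * σ k ^ m = 0 := fun t =>
        (HasDerivAt.fun_sum fun k _ => ((hu k t).const_mul (d k)).mul_const (σ k ^ m)).unique
          (by simpa only [ih] using hasDerivAt_const t (0 : ℝ))
      intro t
      have h2 : ∑ k, d k * -(σ k * u k t) * σ k ^ m = 0 :=
        (HasDerivAt.fun_sum fun k _ =>
          (((hw k t).const_mul (σ k)).neg.const_mul (d k)).mul_const (σ k ^ m)).unique
          (by simpa only [Pi.neg_apply, h1] using hasDerivAt_const t (0 : ℝ))
      rw [← neg_eq_zero, ← Finset.sum_neg_distrib, ← h2]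
      exact Finset.sum_congr rfl fun k _ => by ring
  exact congrFun (Matrix.eq_zero_of_forall_pow_sum_mul_pow_eq_zero hσ
    (v := fun k => d k * u k t) fun m => hpow m t) k

/-! ### Multiplicity of the eigenvalue zero -/

theorem rootMultiplicity_zero_charpoly_eq_finrank_ker {q : ℕ} {G : Matrix (Fin q) (Fin q) ℝ}
    (hG : G.IsHermitian) :
    G.charpoly.rootMultiplicity 0 = Module.finrank ℝ (LinearMap.ker G.mulVecLin) := by
  have h1 := hG.rank_eq_card_non_zero_eigs
  have h2 := LinearMap.finrank_range_add_finrank_ker G.mulVecLin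
  rw [Module.finrank_fin_fun] at h2
  have h3 : G.charpoly.rootMultiplicity 0 = Fintype.card {i // hG.eigenvalues i = 0} := by
    rw [← Polynomial.count_roots, hG.roots_charpoly_eq_eigenvalues, Multiset.count_map,
      Fintype.card_subtype, Finset.card_def, Finset.filter_val]
    simp [eq_comm]
  have h4 := Fintype.card_subtype_compl (fun i => hG.eigenvalues i = 0)
  have h5 := Fintype.card_subtype_le (fun i => hG.eigenvalues i = 0)
  simp only [Fintype.card_fin] at h4 h5
  change G.rank + _ = _ at h2
  change G.rank = Fintype.card {i // ¬ hG.eigenvalues i = 0} at h1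
  omega

theorem rootMultiplicity_zero_charpoly_eq_one_iff {q : ℕ} {G : Matrix (Fin q) (Fin q) ℝ}
    (hG : G.IsHermitian) {u : Fin q → ℝ} (hu : u ≠ 0) (hGu : G *ᵥ u = 0) :
    G.charpoly.rootMultiplicity 0 = 1 ↔ ∀ x, G *ᵥ x = 0 → ∃ a : ℝ, a • u = x := by
  rw [rootMultiplicity_zero_charpoly_eq_finrank_ker hG,
    finrank_eq_one_iff_of_nonzero' (⟨u, by simpa using hGu⟩ : LinearMap.ker G.mulVecLin)
      (by simpa [Subtype.ext_iff] using hu)]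
  simp [Subtype.ext_iff]

/-- The head of the list must be `0`, so a second zero exists exactly when the next entry is `0`. -/
theorem sortedLE_get_one_pos_iff {l : List ℝ} (hl : l.Pairwise (· ≤ ·)) (h0 : ∀ x ∈ l, 0 ≤ x)
    (hmem : 0 ∈ l) (h1 : 1 < l.length) : 0 < l.get ⟨1, h1⟩ ↔ l.count 0 = 1 := by
  match l, h1 with
  | a :: b :: l, h1 =>
    rw [List.pairwise_cons, List.pairwise_cons] at hl
    have ha : a = 0 := by
      refine le_antisymm ?_ (h0 a (by simp))
      rcases List.mem_cons.mp hmem with h | h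
      · exact h.symm.le
      · exact hl.1 0 h
    subst ha
    rw [List.count_cons_self]
    simp only [List.get_eq_getElem, List.getElem_cons_succ, List.getElem_cons_zero]
    rw [Nat.add_eq_right, List.count_eq_zero]
    constructor
    · intro hb hmem'
      rcases List.mem_cons.mp hmem' with h | h
      · exact hb.ne h
      · exact absurd (hl.2.1 0 h) (not_le.mpr hb)
    · intro h
      refine lt_of_le_of_ne (h0 b (by simp)) fun hb => h (by simp [hb])

theorem map_re_roots_charpoly_map_ofReal {q : ℕ} {G : Matrix (Fin q) (Fin q) ℝ}
    (hG : G.IsHermitian) :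
    ((G.map Complex.ofReal).charpoly.roots.map Complex.re) = G.charpoly.roots := by
  have h : (G.map Complex.ofReal).charpoly = G.charpoly.map Complex.ofRealHom :=
    Matrix.charpoly_map G Complex.ofRealHom
  have hs : G.charpoly.Splits := by
    rw [hG.charpoly_eq]
    exact Polynomial.Splits.prod fun i _ => Polynomial.Splits.X_sub_C _
  rw [h, hs.roots_map, Multiset.map_map]
  simp

theorem reEigenvalue_one_pos_iff {q : ℕ} (hq : 2 ≤ q) {G : Matrix (Fin q) (Fin q) ℝ}
    (hG : G.PosSemidef) {u : Fin q → ℝ} (hu : u ≠ 0) (hGu : G *ᵥ u = 0) :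
    0 < reEigenvalue (G.map Complex.ofReal) ⟨1, hq⟩ ↔ G.charpoly.rootMultiplicity 0 = 1 := by
  have hmem : (0 : ℝ) ∈ G.charpoly.roots := by
    rw [← Multiset.count_pos, Polynomial.count_roots,
      rootMultiplicity_zero_charpoly_eq_finrank_ker hG.1]
    have : Nontrivial (LinearMap.ker G.mulVecLin) :=
      ⟨⟨⟨u, by simpa using hGu⟩, 0, by simpa [Subtype.ext_iff] using hu⟩⟩
    exact Module.finrank_pos
  have hnonneg : ∀ x ∈ G.charpoly.roots, 0 ≤ x := by
    intro x hx
    rw [hG.1.roots_charpoly_eq_eigenvalues] at hx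
    obtain ⟨i, -, rfl⟩ := Multiset.mem_map.mp hx
    exact hG.eigenvalues_nonneg i
  have hsort := map_re_roots_charpoly_map_ofReal hG.1
  rw [← Polynomial.count_roots, ← hsort, ← Multiset.sort_eq
    ((G.map Complex.ofReal).charpoly.roots.map Complex.re) (· ≤ ·), Multiset.coe_count]
  refine sortedLE_get_one_pos_iff (Multiset.pairwise_sort _ _) ?_ ?_ _
  · simpa only [Multiset.mem_sort, hsort] using hnonneg
  · rwa [Multiset.mem_sort, hsort]

/-! ### The array in modal coordinates -/

section Modal

variable {σ : Fin n → ℝ} {B : Fin q → Fin q → Matrix (Fin n) (Fin n) ℝ}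

/-- The first order vector field on phase space of the array in modal coordinates. -/
def modalField (σ : Fin n → ℝ) (B : Fin q → Fin q → Matrix (Fin n) (Fin n) ℝ) :
    ((Fin q → Fin n → ℝ) × (Fin q → Fin n → ℝ)) →ₗ[ℝ]
      ((Fin q → Fin n → ℝ) × (Fin q → Fin n → ℝ)) where
  toFun z := (z.2, fun i => -(Matrix.diagonal σ *ᵥ z.1 i) - ∑ j, B i j *ᵥ (z.2 i - z.2 j))
  map_add' z z' := by
    refine Prod.ext rfl (funext fun i => ?_)
    simp only [Prod.fst_add, Prod.snd_add, Pi.add_apply, Matrix.mulVec_add, Matrix.mulVec_sub,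
      Finset.sum_add_distrib, Finset.sum_sub_distrib]
    abel
  map_smul' c z := by
    refine Prod.ext rfl (funext fun i => ?_)
    simp only [Prod.smul_fst, Prod.smul_snd, Pi.smul_apply, Matrix.mulVec_smul, ← smul_sub,
      ← Finset.smul_sum, RingHom.id_apply, ← smul_neg]

/-- Twice the mechanical energy in modal coordinates. -/
def modalEnergy (σ : Fin n → ℝ) (z : (Fin q → Fin n → ℝ) × (Fin q → Fin n → ℝ)) : ℝ :=
  ∑ i, ∑ k, (z.2 i k ^ 2 + σ k * z.1 i k ^ 2)

theorem continuous_modalEnergy : Continuous (modalEnergy (q := q) σ) := by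
  unfold modalEnergy
  fun_prop

theorem modalEnergy_term_nonneg (hσ : ∀ k, 0 < σ k)
    (z : (Fin q → Fin n → ℝ) × (Fin q → Fin n → ℝ)) (i : Fin q) (k : Fin n) :
    0 ≤ z.2 i k ^ 2 + σ k * z.1 i k ^ 2 :=
  add_nonneg (sq_nonneg _) (mul_nonneg (hσ k).le (sq_nonneg _))

theorem modalEnergy_nonneg (hσ : ∀ k, 0 < σ k)
    (z : (Fin q → Fin n → ℝ) × (Fin q → Fin n → ℝ)) : 0 ≤ modalEnergy σ z :=
  Finset.sum_nonneg fun i _ => Finset.sum_nonneg fun k _ => modalEnergy_term_nonneg hσ z i k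

theorem isBounded_modalEnergy_le (hσ : ∀ k, 0 < σ k) (C : ℝ) :
    Bornology.IsBounded
      {z : (Fin q → Fin n → ℝ) × (Fin q → Fin n → ℝ) | modalEnergy σ z ≤ C} := by
  have hterm : ∀ z ∈ {z : (Fin q → Fin n → ℝ) × (Fin q → Fin n → ℝ) | modalEnergy σ z ≤ C},
      ∀ i k, z.2 i k ^ 2 + σ k * z.1 i k ^ 2 ≤ C := by
    intro z hz i k
    refine le_trans ?_ hz
    refine le_trans (Finset.single_le_sum
      (f := fun k => z.2 i k ^ 2 + σ k * z.1 i k ^ 2)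
      (fun k _ => modalEnergy_term_nonneg hσ z i k) (Finset.mem_univ k)) ?_
    exact Finset.single_le_sum (f := fun i => ∑ k, (z.2 i k ^ 2 + σ k * z.1 i k ^ 2))
      (fun i _ => Finset.sum_nonneg fun k _ => modalEnergy_term_nonneg hσ z i k)
      (Finset.mem_univ i)
  rw [← Bornology.isBounded_image_fst_and_snd]
  constructor
  · refine Bornology.forall_isBounded_image_eval_iff.mp fun i => ?_
    refine Bornology.forall_isBounded_image_eval_iff.mp fun k => ?_
    refine isBounded_iff_forall_norm_le.mpr ⟨√(C / σ k), ?_⟩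
    rintro _ ⟨_, ⟨_, ⟨z, hz, rfl⟩, rfl⟩, rfl⟩
    refine Real.abs_le_sqrt ?_
    rw [le_div_iff₀ (hσ k)]
    have := hterm z hz i k
    simp only [Function.eval]
    nlinarith [sq_nonneg (z.2 i k)]
  · refine Bornology.forall_isBounded_image_eval_iff.mp fun i => ?_
    refine Bornology.forall_isBounded_image_eval_iff.mp fun k => ?_
    refine isBounded_iff_forall_norm_le.mpr ⟨√C, ?_⟩
    rintro _ ⟨_, ⟨_, ⟨z, hz, rfl⟩, rfl⟩, rfl⟩
    refine Real.abs_le_sqrt ?_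
    have := hterm z hz i k
    have := mul_nonneg (hσ k).le (sq_nonneg (z.1 i k))
    simp only [Function.eval]
    linarith

variable {z : ℝ → (Fin q → Fin n → ℝ) × (Fin q → Fin n → ℝ)}

theorem hasDerivAt_modal_fst {t : ℝ} (hz : HasDerivAt z (modalField σ B (z t)) t)
    (i : Fin q) (k : Fin n) : HasDerivAt (fun s => (z s).1 i k) ((z t).2 i k) t :=
  hasDerivAt_pi.mp (hasDerivAt_pi.mp hz.fst i) k

theorem hasDerivAt_modal_snd {t : ℝ} (hz : HasDerivAt z (modalField σ B (z t)) t)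
    (i : Fin q) (k : Fin n) : HasDerivAt (fun s => (z s).2 i k)
      (-(σ k * (z t).1 i k) - (∑ j, B i j *ᵥ ((z t).2 i - (z t).2 j)) k) t := by
  have h := hasDerivAt_pi.mp (hasDerivAt_pi.mp hz.snd i) k
  simpa only [modalField, LinearMap.coe_mk, AddHom.coe_mk, Pi.sub_apply, Pi.neg_apply,
    Matrix.mulVec_diagonal] using h

/-- Restoring forces cancel against the potential term, leaving the dissipated power. The factor
from doubling the energy is absorbed by summing over ordered pairs. -/
theorem hasDerivAt_modalEnergy (hBsymm : ∀ i j, B i j = B j i) {t : ℝ}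
    (hz : HasDerivAt z (modalField σ B (z t)) t) :
    HasDerivAt (fun s => modalEnergy σ (z s))
      (-∑ i, ∑ j, ((z t).2 i - (z t).2 j) ⬝ᵥ B i j *ᵥ ((z t).2 i - (z t).2 j)) t := by
  have h := HasDerivAt.fun_sum (u := Finset.univ) fun i (_ : i ∈ Finset.univ) =>
    HasDerivAt.fun_sum (u := Finset.univ) fun k (_ : k ∈ Finset.univ) =>
      ((hasDerivAt_modal_snd hz i k).pow 2).add
        (((hasDerivAt_modal_fst hz i k).pow 2).const_mul (σ k))
  refine h.congr_deriv ?_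
  rw [← two_mul_sum_dotProduct_of_antisymm (z t).2
    (F := fun i j => B i j *ᵥ ((z t).2 i - (z t).2 j))
    (fun i j => by rw [hBsymm j i, ← Matrix.mulVec_neg, neg_sub]),
    Finset.mul_sum, ← Finset.sum_neg_distrib]
  refine Finset.sum_congr rfl fun i _ => ?_
  rw [dotProduct, Finset.mul_sum, ← Finset.sum_neg_distrib]
  refine Finset.sum_congr rfl fun k _ => ?_
  push_cast
  ring

theorem modal_synchronizes (hσ : Function.Injective σ) (hσ_pos : ∀ k, 0 < σ k)
    (hB : ∀ i j, (B i j).PosSemidef) (hBsymm : ∀ i j, B i j = B j i) (hBdiag : ∀ i, B i i = 0)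
    (hker : ∀ k x, weightedLaplacian (fun i j => B i j k k) *ᵥ x = 0 → ∀ i j, x i = x j) :
    Synchronizes 1 (Matrix.diagonal σ) B := by
  rw [synchronizes_iff]
  rintro x ⟨y, a, hx⟩ i j
  have hdiss : ∀ (z : (Fin q → Fin n → ℝ) × (Fin q → Fin n → ℝ)) i j,
      0 ≤ (z.2 i - z.2 j) ⬝ᵥ B i j *ᵥ (z.2 i - z.2 j) := fun z i j => by
    simpa using (hB i j).dotProduct_mulVec_nonneg (z.2 i - z.2 j)
  refine tendsto_of_constant_energy (modalField σ B).toContinuousLinearMap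
    (E := modalEnergy σ) continuous_modalEnergy (Φ := fun z => z.1 i - z.1 j) (by fun_prop)
    (modalEnergy_nonneg hσ_pos) (isBounded_modalEnergy_le hσ_pos) ?_ ?_
    (z := fun t => (fun i => x i t, fun i => y i t)) ?_
  · intro z hz
    refine antitone_of_hasDerivAt_nonpos (fun t => hasDerivAt_modalEnergy hBsymm (hz t)) ?_
    exact fun t => neg_nonpos.mpr
      (Finset.sum_nonneg fun i _ => Finset.sum_nonneg fun j _ => hdiss (z t) i j)
  · intro z hz hconst
    -- Constant energy makes a sum of nonnegative dissipation terms vanish, hence each term;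
    -- semidefiniteness upgrades this from the quadratic form to the vector.
    have hzero : ∀ t i j, B i j *ᵥ ((z t).2 i - (z t).2 j) = 0 := by
      intro t i j
      have h0 : HasDerivAt (fun s => modalEnergy σ (z s)) 0 t := by
        rw [funext fun s => hconst s 0]
        exact hasDerivAt_const _ _
      have h := neg_eq_zero.mp ((hasDerivAt_modalEnergy hBsymm (hz t)).unique h0)
      rw [Finset.sum_eq_zero_iff_of_nonneg fun i _ => Finset.sum_nonneg fun j _ =>
        hdiss (z t) i j] at h
      have h' := (Finset.sum_eq_zero_iff_of_nonneg fun j _ => hdiss (z t) i j).mp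
        (h i (Finset.mem_univ i)) j (Finset.mem_univ j)
      exact ((hB i j).dotProduct_mulVec_zero_iff _).mp (by simpa using h')
    have hvel : ∀ i k t, HasDerivAt (fun s => (z s).2 i k) (-(σ k * (z t).1 i k)) t := by
      intro i k t
      simpa [hzero] using hasDerivAt_modal_snd (hz t) i k
    have hpos : ∀ i k t, HasDerivAt (fun s => (z s).1 i k) ((z t).2 i k) t :=
      fun i k t => hasDerivAt_modal_fst (hz t) i k
    have hmode : ∀ k t i j, B i j k k * ((z t).2 i k - (z t).2 j k) = 0 := by
      intro k t i j
      refine mul_eq_zero_of_forall_sum_mul_eq_zero hσ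
        (w := fun l s => (z s).1 i l - (z s).1 j l) (u := fun l s => (z s).2 i l - (z s).2 j l)
        (d := fun l => B i j k l) (fun l s => (hpos i l s).sub (hpos j l s))
        (fun l s => ((hvel i l s).sub (hvel j l s)).congr_deriv (by ring)) ?_ k t
      intro s
      simpa [Matrix.mulVec, dotProduct] using congrFun (hzero s i j) k
    have hsync : ∀ k t, (z t).2 i k = (z t).2 j k := by
      intro k t
      refine hker k (fun i => (z t).2 i k) ?_ i j
      ext l
      rw [weightedLaplacian_mulVec (fun i => by rw [hBdiag]; rfl)]
      exact Finset.sum_eq_zero fun m _ => hmode k t l m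
    ext k
    -- Equal velocities at all times have equal derivatives `-(σ k * position)`, and `σ k ≠ 0` gives
    -- equal positions.
    have h := (hvel i k 0).unique
      (by simpa only [funext (hsync k)] using hvel j k 0)
    have h' := mul_left_cancel₀ (hσ_pos k).ne' (neg_injective h)
    simp [h']
  · intro t
    have hfield : (modalField σ B).toContinuousLinearMap (fun i => x i t, fun i => y i t) =
        (fun i => y i t, fun i => a i t) := by
      refine Prod.ext rfl (funext fun i => ?_)
      have h := (hx i t).2.2
      rw [Matrix.one_mulVec, add_assoc] at h
      simp only [LinearMap.coe_toContinuousLinearMap', modalField, LinearMap.coe_mk,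
        AddHom.coe_mk]
      rw [eq_neg_of_add_eq_zero_left h]
      abel
    rw [hfield]
    exact (hasDerivAt_pi.mpr fun i => (hx i t).1).prodMk (hasDerivAt_pi.mpr fun i => (hx i t).2.1)

theorem eq_of_modal_synchronizes (hσ_pos : ∀ k, 0 < σ k)
    (hB : ∀ i j, (B i j).PosSemidef) (hBsymm : ∀ i j, B i j = B j i) (hBdiag : ∀ i, B i i = 0)
    (hsync : Synchronizes 1 (Matrix.diagonal σ) B) {k : Fin n} {c : Fin q → ℝ}
    (hc : weightedLaplacian (fun i j => B i j k k) *ᵥ c = 0) (i j : Fin q) : c i = c j := by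
  -- Either `c i = c j`, or the diagonal entry `B i j k k` is zero and semidefiniteness forces `B i
  -- j` to kill the `k`th basis vector. So motion in mode `k` with amplitudes `c` feels no damping.
  have hcoupling : ∀ i j, (c i - c j) • B i j *ᵥ Pi.single k 1 = 0 := by
    intro i j
    have h := mul_sub_eq_zero_of_weightedLaplacian_mulVec_eq_zero
      (fun i j => by rw [hBsymm i j]) (fun i => by rw [hBdiag]; rfl)
      (fun i j => (hB i j).diag_nonneg) hc i j
    rcases mul_eq_zero.mp h with h0 | h0
    · rw [((hB i j).dotProduct_mulVec_zero_iff (Pi.single k 1)).mp (by simpa using h0), smul_zero]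
    · rw [h0, zero_smul]
  set ω := √(σ k)
  have hω2 : ω * ω = σ k := Real.mul_self_sqrt (hσ_pos k).le
  have hω_pos : 0 < ω := Real.sqrt_pos.mpr (hσ_pos k)
  have hin : ∀ t : ℝ, HasDerivAt (fun s : ℝ => ω * s) ω t := fun t => by
    simpa using (hasDerivAt_id t).const_mul ω
  have hsol : IsSolution 1 (Matrix.diagonal σ) B
      (fun i t => (c i * Real.cos (ω * t)) • Pi.single k (1 : ℝ)) := by
    refine ⟨fun i t => (c i * (-Real.sin (ω * t) * ω)) • Pi.single k (1 : ℝ),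
      fun i t => (c i * (-(Real.cos (ω * t) * ω) * ω)) • Pi.single k (1 : ℝ), fun i t =>
      ⟨((hin t).cos.const_mul (c i)).smul_const _,
        (((hin t).sin.neg.mul_const ω).const_mul (c i)).smul_const _, ?_⟩⟩
    have hsum : ∑ j, B i j *ᵥ ((c i * (-Real.sin (ω * t) * ω)) • Pi.single k (1 : ℝ) -
        (c j * (-Real.sin (ω * t) * ω)) • Pi.single k (1 : ℝ)) = 0 := by
      refine Finset.sum_eq_zero fun j _ => ?_
      rw [← sub_smul, ← sub_mul, mul_comm, mul_smul, Matrix.mulVec_smul, Matrix.mulVec_smul,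
        hcoupling, smul_zero]
    rw [hsum, add_zero, Matrix.one_mulVec]
    ext l
    rw [Pi.add_apply, Matrix.mulVec_diagonal]
    by_cases hl : l = k
    · subst hl
      simp only [Pi.smul_apply, Pi.single_eq_same, smul_eq_mul, mul_one, Pi.zero_apply, ← hω2]
      ring
    · simp [hl]
  have hlim := synchronizes_iff.mp hsync _ hsol i j
  -- Sampling at whole periods makes every cosine `1`, so the difference is constantly `c i - c j`.
  have hlim' : Tendsto (fun m : ℕ => (m : ℝ) * (2 * Real.pi / ω)) atTop atTop :=
    tendsto_natCast_atTop_atTop.atTop_mul_const (by positivity)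
  have h1 := ((continuous_apply k).tendsto (0 : Fin n → ℝ)).comp (hlim.comp hlim')
  have h2 : ∀ m : ℕ, Real.cos (ω * (m * (2 * Real.pi / ω))) = 1 := fun m => by
    rw [show ω * (m * (2 * Real.pi / ω)) = m * (2 * Real.pi) by field_simp]
    exact Real.cos_nat_mul_two_pi m
  simp only [Function.comp_def, h2, Pi.sub_apply, Pi.smul_apply, Pi.single_eq_same, smul_eq_mul,
    mul_one, Pi.zero_apply] at h1
  exact sub_eq_zero.mp (tendsto_nhds_unique tendsto_const_nhds h1)

theorem modal_synchronizes_iff (hσ : Function.Injective σ) (hσ_pos : ∀ k, 0 < σ k)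
    (hB : ∀ i j, (B i j).PosSemidef) (hBsymm : ∀ i j, B i j = B j i)
    (hBdiag : ∀ i, B i i = 0) :
    Synchronizes 1 (Matrix.diagonal σ) B ↔
      ∀ k x, weightedLaplacian (fun i j => B i j k k) *ᵥ x = 0 → ∀ i j, x i = x j :=
  ⟨fun h _ _ hx => eq_of_modal_synchronizes hσ_pos hB hBsymm hBdiag h hx,
    modal_synchronizes hσ hσ_pos hB hBsymm hBdiag⟩

end Modal

/-! ### Normalization by the inverse square root of the mass matrix -/

theorem posDef_sqrt {M : Matrix (Fin n) (Fin n) ℝ} (hM : M.PosDef) : (CFC.sqrt M).PosDef := by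
  rw [Matrix.PosSemidef.posDef_iff_isUnit (Matrix.nonneg_iff_posSemidef.mp (CFC.sqrt_nonneg M)),
    CFC.isUnit_sqrt_iff M hM.posSemidef.nonneg]
  exact hM.isUnit

theorem posDef_invSqrt {M : Matrix (Fin n) (Fin n) ℝ} (hM : M.PosDef) : (invSqrt M).PosDef :=
  (posDef_sqrt hM).inv

theorem transpose_invSqrt {M : Matrix (Fin n) (Fin n) ℝ} (hM : M.PosDef) :
    (invSqrt M)ᵀ = invSqrt M := by
  simpa using (posDef_invSqrt hM).1.eq

theorem invSqrt_mul_mul_invSqrt {M : Matrix (Fin n) (Fin n) ℝ} (hM : M.PosDef) :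
    invSqrt M * M * invSqrt M = 1 := by
  have hu := (Matrix.isUnit_iff_isUnit_det _).mp (posDef_sqrt hM).isUnit
  have hs := CFC.sqrt_mul_sqrt_self M hM.posSemidef.nonneg
  calc invSqrt M * M * invSqrt M
      = (CFC.sqrt M)⁻¹ * (CFC.sqrt M * CFC.sqrt M) * (CFC.sqrt M)⁻¹ := by rw [hs, invSqrt]
    _ = 1 := by
      rw [← mul_assoc, Matrix.nonsing_inv_mul _ hu, one_mul, Matrix.mul_nonsing_inv _ hu]

theorem dotProduct_eq_zero_of_mulVec_eq_smul {P : Matrix (Fin n) (Fin n) ℝ} (hP : Pᵀ = P)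
    {u w : Fin n → ℝ} {a b : ℝ} (hab : a ≠ b) (hu : P *ᵥ u = a • u) (hw : P *ᵥ w = b • w) :
    u ⬝ᵥ w = 0 := by
  have h : (P *ᵥ u) ⬝ᵥ w = u ⬝ᵥ P *ᵥ w := by
    rw [Matrix.dotProduct_mulVec, ← Matrix.mulVec_transpose, hP]
  rw [hu, hw, smul_dotProduct, dotProduct_smul, smul_eq_mul, smul_eq_mul] at h
  have h' : (a - b) * (u ⬝ᵥ w) = 0 := by rw [sub_mul, h, sub_self]
  exact (mul_eq_zero.mp h').resolve_left (sub_ne_zero.mpr hab)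

/-- The projection acts block by block, so each matrix weight is replaced by its quadratic form at
`v`. -/
theorem projectedLaplacian_lap {W : Fin q → Fin q → Matrix (Fin n) (Fin n) ℝ} (v : Fin n → ℝ) :
    projectedLaplacian (lap W) v = weightedLaplacian fun i j => v ⬝ᵥ W i j *ᵥ v := by
  ext i j
  have h : projectedLaplacian (lap W) v i j = ∑ b, (∑ a, v a * lap W (i, a) (j, b)) * v b := by
    simp [projectedLaplacian, Matrix.mul_apply, Fintype.sum_prod_type, Matrix.kroneckerMap_apply,
      Matrix.one_apply, ite_mul, mul_ite, Finset.sum_ite_irrel]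
  have hquad : ∀ X : Matrix (Fin n) (Fin n) ℝ, v ⬝ᵥ X *ᵥ v = ∑ b, (∑ a, v a * X a b) * v b := by
    intro X
    rw [Matrix.dotProduct_mulVec]
    rfl
  rw [h]
  by_cases hij : i = j
  · subst hij
    have hsum : ∑ l, v ⬝ᵥ W i l *ᵥ v = v ⬝ᵥ (∑ l, W i l) *ᵥ v := by
      rw [Matrix.sum_mulVec, dotProduct_sum]
    simp only [lap, weightedLaplacian, Matrix.of_apply, if_true]
    rw [hsum, hquad]
    simp only [Matrix.sum_apply]
  · simp [lap, weightedLaplacian, hij, hquad, Finset.sum_neg_distrib]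

end SmallOscillations

/-! ### Passage to modal coordinates and conclusion -/

open SmallOscillations

theorem mainTheorem3 {q n : ℕ} (hq : 1 ≤ q)
    (M K : Matrix (Fin n) (Fin n) ℝ) (hM : M.PosDef) (hK : K.PosDef)
    (D : Fin q → Fin q → Matrix (Fin n) (Fin n) ℝ)
    (hD : ∀ i j, (D i j).PosSemidef) (hDsymm : ∀ i j, D i j = D j i) (hDdiag : ∀ i, D i i = 0)
    (σ : Fin n → ℝ) (hσ : Function.Injective σ)
    (v : Fin n → Fin n → ℝ) (hv_unit : ∀ k, v k ⬝ᵥ v k = 1)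
    (hv : ∀ k, SmallOscillations.normalizedStiffness M K *ᵥ v k = σ k • v k)
    (G : Fin n → Matrix (Fin q) (Fin q) ℝ)
    (hG : ∀ k, G k = SmallOscillations.projectedLaplacian
      (SmallOscillations.dissipativeLaplacian M D) (v k)) :
    (SmallOscillations.Synchronizes M K D ↔
      ∀ k, (G k).charpoly.rootMultiplicity 0 = 1) ∧
    (∀ hq2 : 2 ≤ q, SmallOscillations.Synchronizes M K D ↔
      ∀ k, 0 < SmallOscillations.reEigenvalue ((G k).map Complex.ofReal) ⟨1, hq2⟩) := by
  set S := invSqrt M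
  have hST : Sᵀ = S := transpose_invSqrt hM
  have hP : (normalizedStiffness M K).PosDef := by
    have h := Matrix.IsUnit.posDef_star_left_conjugate_iff (posDef_invSqrt hM).isUnit (x := K)
    have hstar : star (invSqrt M) = invSqrt M := (posDef_invSqrt hM).1.eq
    rw [hstar] at h
    exact h.mpr hK
  have hPT : (normalizedStiffness M K)ᵀ = normalizedStiffness M K := by simpa using hP.1.eq
  have horth : ∀ k l, v k ⬝ᵥ v l = (1 : Matrix (Fin n) (Fin n) ℝ) k l := by
    intro k l
    by_cases hkl : k = l
    · subst hkl; rw [hv_unit, Matrix.one_apply_eq]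
    · rw [Matrix.one_apply_ne hkl]
      exact dotProduct_eq_zero_of_mulVec_eq_smul hPT (hσ.ne hkl) (hv k) (hv l)
  have hσ_pos : ∀ k, 0 < σ k := by
    intro k
    have hne : v k ≠ 0 := fun h0 => by simpa [h0] using hv_unit k
    have h := hP.dotProduct_mulVec_pos hne
    rwa [hv, star_trivial, dotProduct_smul, hv_unit, smul_eq_mul, mul_one] at h
  set U : Matrix (Fin n) (Fin n) ℝ := (Matrix.of v)ᵀ
  have hconj : ∀ (X : Matrix (Fin n) (Fin n) ℝ) k l,
      ((S * U)ᵀ * X * (S * U)) k l = v k ⬝ᵥ (S * X * S) *ᵥ v l := by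
    intro X k l
    have : (S * U)ᵀ * X * (S * U) = Uᵀ * ((S * X * S) * U) := by
      rw [Matrix.transpose_mul, hST]; simp only [mul_assoc]
    rw [this]
    rfl
  have hM1 : (S * U)ᵀ * M * (S * U) = 1 := by
    ext k l
    rw [hconj, invSqrt_mul_mul_invSqrt hM, Matrix.one_mulVec, horth]
  have hK1 : (S * U)ᵀ * K * (S * U) = Matrix.diagonal σ := by
    ext k l
    have h : (S * K * S) *ᵥ v l = σ l • v l := hv l
    rw [hconj, h, dotProduct_smul, horth, Matrix.diagonal_apply, Matrix.one_apply, smul_eq_mul]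
    by_cases hkl : k = l
    · simp [hkl]
    · simp [hkl]
  set B : Fin q → Fin q → Matrix (Fin n) (Fin n) ℝ := fun i j => (S * U)ᵀ * D i j * (S * U)
  have hB : ∀ i j, (B i j).PosSemidef := fun i j => by
    exact (hD i j).conjTranspose_mul_mul_same (S * U)
  have hBsymm : ∀ i j, B i j = B j i := fun i j => by simp only [B, hDsymm i j]
  have hBdiag : ∀ i, B i i = 0 := fun i => by simp [B, hDdiag]
  have hGB : ∀ k, G k = weightedLaplacian fun i j => B i j k k := by
    intro k
    rw [hG, dissipativeLaplacian, projectedLaplacian_lap]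
    exact congrArg weightedLaplacian (funext fun i => funext fun j => (hconj (D i j) k k).symm)
  have hcongr : Synchronizes M K D ↔
      ∀ k x, G k *ᵥ x = 0 → ∀ i j, x i = x j := by
    -- `hM1` exhibits `(S * U)ᵀ * M` as a left inverse of `S * U`; for square matrices it is also
    -- the right inverse needed here.
    rw [← synchronizes_congruence_iff (mul_eq_one_comm.mp hM1), hM1, hK1,
      modal_synchronizes_iff hσ hσ_pos hB hBsymm hBdiag]
    simp only [hGB]
  have hgdiag : ∀ k i, B i i k k = 0 := fun k i => by rw [hBdiag]; rfl
  have hGpsd : ∀ k, (G k).PosSemidef := fun k => by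
    rw [hGB]
    exact weightedLaplacian_posSemidef (fun i j => by rw [hBsymm i j]) (hgdiag k)
      fun i j => (hB i j).diag_nonneg
  have hG1 : ∀ k, G k *ᵥ 1 = 0 := fun k => by
    rw [hGB]
    exact weightedLaplacian_mulVec_one (hgdiag k)
  have hone : (1 : Fin q → ℝ) ≠ 0 := fun h => one_ne_zero (congrFun h ⟨0, hq⟩)
  have hmain : Synchronizes M K D ↔ ∀ k, (G k).charpoly.rootMultiplicity 0 = 1 := by
    rw [hcongr]
    refine forall_congr' fun k => ?_
    rw [rootMultiplicity_zero_charpoly_eq_one_iff (hGpsd k).1 hone (hG1 k)]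
    refine forall₂_congr fun x _ => ⟨fun h => ⟨x ⟨0, hq⟩, ?_⟩, ?_⟩
    · ext i
      simp [h i ⟨0, hq⟩]
    · rintro ⟨a, rfl⟩ i j
      simp
  refine ⟨hmain, fun hq2 => hmain.trans (forall_congr' fun k => ?_)⟩
  exact (reEigenvalue_one_pos_iff hq2 (hGpsd k) hone (hG1 k)).symm
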